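/- For a rational square matrix $Q$, the level of $Q$ is the least integer $\ell\geq 1$ such that $\ell Q$ has integer entries. Denote by $\mathbb{O}_n(\ell,\mathbb{Q})$ the set of all orthogonal matrices $Q\in\mathbb{Q}^{n\times n}$ of level $\ell$. Let $1\leq n\leq 3$ and, for every $k\geq 1$, let $X_k$ be a random symmetric $n\times n$ matrix whose upper-triangular entries $\{(X_k)_{i,j} : i\leq j\}$ are independent and uniformly distributed on $\{1,\ldots,k\}$. Then the limits below exist, and $$\lim_{L\to\infty}\ \lim_{k\to\infty}\ \mathbb{P}\Bigl(\exists\, Q\in \bigcup_{\ell=2}^{L}\mathbb{O}_n(\ell,\mathbb{Q}) : Q^{\mathsf T}X_kQ\in\mathbb{Z}^{n\times n}\Bigr)<1.$$ -/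

import Mathlib

open MeasureTheory ProbabilityTheory Filter Topology

/-- All entries of the rational matrix `A` are integers. -/
def IsIntegerMatrix {n : ℕ} (A : Matrix (Fin n) (Fin n) ℚ) : Prop :=
  ∀ i j, ∃ z : ℤ, A i j = (z : ℚ)

/-- The level of a rational matrix `Q`: the least positive integer `ℓ` such that `ℓ Q` has
integer entries. -/
noncomputable def matrixLevel {n : ℕ} (Q : Matrix (Fin n) (Fin n) ℚ) : ℕ :=
  sInf {ℓ : ℕ | 1 ≤ ℓ ∧ IsIntegerMatrix ((ℓ : ℚ) • Q)}

/-- The infimum defining the level is attained: it really is a least element. -/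
theorem isLeast_matrixLevel {n : ℕ} (Q : Matrix (Fin n) (Fin n) ℚ) :
    IsLeast {ℓ : ℕ | 1 ≤ ℓ ∧ IsIntegerMatrix ((ℓ : ℚ) • Q)} (matrixLevel Q) := by
  have hne : {ℓ : ℕ | 1 ≤ ℓ ∧ IsIntegerMatrix ((ℓ : ℚ) • Q)}.Nonempty := by
    refine ⟨∏ p : Fin n × Fin n, (Q p.1 p.2).den, ?_, ?_⟩
    · exact Nat.one_le_iff_ne_zero.mpr
        (Finset.prod_ne_zero_iff.mpr fun p _ => (Q p.1 p.2).den_nz)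
    · intro i j
      obtain ⟨c, hc⟩ := Finset.dvd_prod_of_mem (fun p : Fin n × Fin n => (Q p.1 p.2).den)
        (Finset.mem_univ (i, j))
      refine ⟨c * (Q i j).num, ?_⟩
      have h := Rat.den_mul_eq_num (Q i j)
      rw [Matrix.smul_apply, hc, smul_eq_mul]
      push_cast
      rw [← h]
      ring
  exact ⟨Nat.sInf_mem hne, fun m hm => Nat.sInf_le hm⟩

/-- The set of rational orthogonal `n × n` matrices of level `ℓ`. -/
def rationalOrthogonalOfLevel (n ℓ : ℕ) : Set (Matrix (Fin n) (Fin n) ℚ) :=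
  {Q | Q ∈ Matrix.orthogonalGroup (Fin n) ℚ ∧ matrixLevel Q = ℓ}

/-- `X` is a random symmetric integer `n × n` matrix on the probability space `(Ω, P)` whose
upper-triangular entries (diagonal included) are independent and uniform on `{1, …, k}`. -/
structure IsUniformSymmetricMatrix {Ω : Type*} [MeasurableSpace Ω] (P : Measure Ω) {n : ℕ}
    (k : ℕ) (X : Ω → Matrix (Fin n) (Fin n) ℤ) : Prop where
  isSymm : ∀ ω, (X ω).IsSymm
  indep : iIndepFun (fun (p : {p : Fin n × Fin n // p.1 ≤ p.2}) (ω : Ω) => X ω p.1.1 p.1.2) P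
  uniform : ∀ i j, i ≤ j → HasLaw (fun ω => X ω i j) (uniformOn (Set.Icc (1 : ℤ) k)) P

/-- The integer matrix `X` is conjugated to an integer matrix by some rational
orthogonal matrix whose level lies between `2` and `L`. -/
def HasIntegralConjugation {n : ℕ} (L : ℕ) (X : Matrix (Fin n) (Fin n) ℤ) : Prop :=
  ∃ Q ∈ ⋃ ℓ ∈ Set.Icc 2 L, rationalOrthogonalOfLevel n ℓ,
    IsIntegerMatrix (Q.transpose * X.map (Int.cast : ℤ → ℚ) * Q)

/-! Clear denominators: if `Q` has level `ℓ` and `Qᵀ X Q = Y` is integral, then `U = ℓQ` satisfies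
`Uᵀ U = ℓ²` and `X U = U Y`. For a prime `p ∣ ℓ`, minimality of `ℓ` gives a column `u` of `U` that
is nonzero mod `p`, and `u·u` and `u·Xu` vanish mod `p²`. Since `n ≤ 3`, a totally isotropic space
mod `p` has dimension at most one, so `Xu`, which lies in the column space of `U`, is a multiple of
`u` mod `p`. Moreover `p ≠ 2`, because at most three squares, one of them odd, cannot sum to a
multiple of 4 (`HasIntegralConjugation.exists_mem_isotropicEigenvectorSet`).

For odd `p` such an `X` is rare mod `p²`: a given `w` mod `p` serves a proportion at most `p⁻ⁿ` of
the matrices, there are at most `2pⁿ⁻¹` isotropic `w`, and each `X` is counted at least `p - 1`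
times by scaling. The density is thus at most `2/(p(p-1)) ≤ 3/p²`, and summing over odd `p` gives at
most `3/4 < 1`.

The inner limit exists because the event depends only on `X` mod `(L!)²`, where residues
equidistribute; the outer one because the event grows with `L`. -/

open scoped Matrix

/-! ### Equidistribution of residues -/

/-- Residue classes modulo `N` equidistribute on `{1, …, k}` as `k → ∞`. -/
theorem tendsto_uniformOn_residue (N : ℕ) [NeZero N] (a : ZMod N) :
    Tendsto (fun k : ℕ => (uniformOn (Set.Icc (1 : ℤ) k)).real {z : ℤ | (z : ZMod N) = a})
      atTop (𝓝 (1 / (N : ℝ))) := by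
  classical
  have hN : (0 : ℤ) < N := by exact_mod_cast Nat.pos_of_ne_zero (NeZero.ne N)
  have hNR : (0 : ℝ) < N := by exact_mod_cast hN
  obtain ⟨v, rfl⟩ := ZMod.intCast_surjective a
  have hcard : ∀ k : ℕ, (uniformOn (Set.Icc (1 : ℤ) k)).real {z : ℤ | (z : ZMod N) = v} =
      (((Finset.Ioc (0 : ℤ) k).filter (fun z => z ≡ v [ZMOD N])).card : ℝ) / k := by
    intro k
    have hset : uniformOn (Set.Icc (1 : ℤ) k) {z : ℤ | (z : ZMod N) = v} =
        uniformOn ((Finset.Icc (1 : ℤ) k : Finset ℤ) : Set ℤ)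
          (((Finset.Ioc (0 : ℤ) k).filter (fun z => z ≡ v [ZMOD N]) : Finset ℤ) : Set ℤ) := by
      rw [← uniformOn_inter_self (Set.finite_Icc _ _), Finset.coe_Icc]
      congr 1
      ext z
      simp only [Set.mem_inter_iff, Set.mem_Icc, Set.mem_ofPred_eq, Finset.coe_filter,
        Finset.mem_Ioc, ZMod.intCast_eq_intCast_iff]
      constructor
      · rintro ⟨⟨h1, h2⟩, h3⟩; exact ⟨⟨by omega, h2⟩, h3⟩
      · rintro ⟨⟨h1, h2⟩, h3⟩; exact ⟨⟨by omega, h2⟩, h3⟩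
    rw [measureReal_def, hset, uniformOn_apply_finset]
    have hint : Finset.Icc (1 : ℤ) k ∩ (Finset.Ioc (0 : ℤ) k).filter (fun z => z ≡ v [ZMOD N]) =
        (Finset.Ioc (0 : ℤ) k).filter (fun z => z ≡ v [ZMOD N]) := by
      apply Finset.inter_eq_right.mpr
      intro z hz
      simp only [Finset.mem_filter, Finset.mem_Ioc, Finset.mem_Icc] at hz ⊢
      omega
    rw [hint]
    simp
  -- The count is `⌊(k-v)/N⌋ - ⌊-v/N⌋`, and each floor is off by less than 1 in the same direction.
  have hbound : ∀ k : ℕ,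
      |(((Finset.Ioc (0 : ℤ) k).filter (fun z => z ≡ v [ZMOD N])).card : ℝ) - k / N| ≤ 1 := by
    intro k
    have h := Int.Ioc_filter_modEq_card (0 : ℤ) (k : ℤ) hN v
    set c := ((Finset.Ioc (0 : ℤ) k).filter (fun z => z ≡ v [ZMOD N])).card
    set x : ℚ := (((k : ℤ) : ℚ) - v) / ((N : ℤ) : ℚ)
    set y : ℚ := (((0 : ℤ) : ℚ) - v) / ((N : ℤ) : ℚ)
    have hxy : x - y = (k : ℚ) / N := by simp only [x, y]; push_cast; ring
    have hxy0 : y ≤ x := by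
      have : (0 : ℚ) ≤ (k : ℚ) / N := by positivity
      linarith
    have hfl : ⌊y⌋ ≤ ⌊x⌋ := Int.floor_le_floor hxy0
    rw [max_eq_left (by omega)] at h
    have hq : (c : ℚ) = ⌊x⌋ - ⌊y⌋ := by exact_mod_cast h
    have hb : |(c : ℚ) - k / N| ≤ 1 := by
      rw [hq, ← hxy, abs_le]
      have := Int.floor_le x
      have := Int.lt_floor_add_one x
      have := Int.floor_le y
      have := Int.lt_floor_add_one y
      constructor <;> linarith
    have hb' := (Rat.cast_le (K := ℝ)).mpr hb
    push_cast at hb'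
    exact hb'
  simp_rw [hcard]
  rw [tendsto_iff_norm_sub_tendsto_zero]
  refine squeeze_zero' (Eventually.of_forall fun _ => norm_nonneg _) ?_
    tendsto_one_div_atTop_nhds_zero_nat
  filter_upwards [eventually_ge_atTop 1] with k hk
  have hk0 : (0 : ℝ) < k := by exact_mod_cast hk
  have heq : ∀ c : ℝ, c / k - 1 / N = (c - k / N) / k := by
    intro c; field_simp
  rw [heq, Real.norm_eq_abs, abs_div, abs_of_pos hk0]
  gcongr
  exact hbound k

/-- The joint residue vector modulo `N` of independent uniform variables on `{1, …, k}` is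
asymptotically uniform. -/
theorem tendsto_measureReal_residues {ι : Type*} [Fintype ι] (N : ℕ) [NeZero N]
    (Ω : ℕ → Type*) [∀ k, MeasurableSpace (Ω k)]
    (P : ∀ k, Measure (Ω k)) [∀ k, IsProbabilityMeasure (P k)] (Y : ∀ k, Ω k → ι → ℤ)
    (hind : ∀ k, 1 ≤ k → iIndepFun (fun i ω => Y k ω i) (P k))
    (hlaw : ∀ k, 1 ≤ k → ∀ i, HasLaw (fun ω => Y k ω i) (uniformOn (Set.Icc (1 : ℤ) k)) (P k))
    (A : Set (ι → ZMod N)) :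
    Tendsto (fun k => (P k).real {ω | (fun i => (Y k ω i : ZMod N)) ∈ A}) atTop
      (𝓝 ((A.ncard : ℝ) / (N : ℝ) ^ Fintype.card ι)) := by
  classical
  have hlim : Tendsto (fun k : ℕ => ∑ a ∈ A.toFinset, ∏ i,
      (uniformOn (Set.Icc (1 : ℤ) k)).real {z : ℤ | (z : ZMod N) = a i}) atTop
      (𝓝 (∑ _a ∈ A.toFinset, ∏ _i : ι, (1 / (N : ℝ)))) :=
    tendsto_finsetSum _ fun a _ => tendsto_finsetProd _ fun i _ =>
      tendsto_uniformOn_residue N (a i)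
  have hval : (∑ _a ∈ A.toFinset, ∏ _i : ι, (1 / (N : ℝ))) =
      (A.ncard : ℝ) / (N : ℝ) ^ Fintype.card ι := by
    rw [Set.ncard_eq_toFinset_card']
    simp [div_eq_mul_inv]
  rw [hval] at hlim
  refine hlim.congr' ?_
  filter_upwards [eventually_ge_atTop 1] with k hk
  have hae : ∀ i, AEMeasurable (fun ω => Y k ω i) (P k) := fun i => (hlaw k hk i).aemeasurable
  have hmap := (iIndepFun_iff_map_fun_eq_pi_map hae).mp (hind k hk)
  simp_rw [(hlaw k hk _).map_eq] at hmap
  have hprob : IsProbabilityMeasure (uniformOn (Set.Icc (1 : ℤ) k)) :=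
    isProbabilityMeasure_uniformOn (Set.finite_Icc _ _) ⟨1, by simp; exact_mod_cast hk⟩
  -- The event splits into finitely many disjoint boxes, one per residue vector in `A`; independence
  -- turns each probability into a product.
  have hpre : {ω | (fun i => (Y k ω i : ZMod N)) ∈ A} =
      (fun ω i => Y k ω i) ⁻¹' (⋃ a ∈ A.toFinset,
        Set.univ.pi fun i => {z : ℤ | (z : ZMod N) = a i}) := by
    ext ω
    simp only [Set.mem_ofPred_eq, Set.mem_preimage, Set.mem_iUnion, Set.mem_toFinset,
      Set.mem_univ_pi, exists_prop]
    constructor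
    · intro h; exact ⟨_, h, fun i => rfl⟩
    · rintro ⟨a, ha, h⟩
      rwa [show (fun i => (Y k ω i : ZMod N)) = a from funext h]
  have hmeas : ∀ a : ι → ZMod N,
      MeasurableSet (Set.univ.pi fun i => {z : ℤ | (z : ZMod N) = a i}) := fun a =>
    MeasurableSet.univ_pi fun i => MeasurableSet.of_discrete
  rw [hpre, measureReal_def, ← Measure.map_apply_of_aemeasurable (aemeasurable_pi_lambda _ hae)
    (Finset.measurableSet_biUnion _ fun a _ => hmeas a), hmap, ← measureReal_def,
    measureReal_biUnion_finset _ fun a _ => hmeas a]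
  · refine Finset.sum_congr rfl fun a _ => ?_
    rw [measureReal_def, Measure.pi_pi, ENNReal.toReal_prod]
    rfl
  · intro a _ b _ hab
    rw [Function.onFun, Set.disjoint_left]
    intro z hza hzb
    apply hab
    funext i
    rw [Set.mem_univ_pi] at hza hzb
    exact (hza i).symm.trans (hzb i)

/-! ### Symmetric matrices as upper triangles -/

/-- Positions on or above the diagonal of an `n × n` matrix. -/
abbrev UpperIndex (n : ℕ) : Type := {p : Fin n × Fin n // p.1 ≤ p.2}

/-- The symmetric matrix with given entries on and above the diagonal. -/
def symmOfUpper {n : ℕ} {R : Type*} (x : UpperIndex n → R) : Matrix (Fin n) (Fin n) R :=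
  Matrix.of fun i j => x ⟨(min i j, max i j), min_le_max⟩

theorem symmOfUpper_upper {n : ℕ} {R : Type*} {M : Matrix (Fin n) (Fin n) R} (hM : M.IsSymm) :
    symmOfUpper (fun t : UpperIndex n => M t.1.1 t.1.2) = M := by
  ext i j
  rcases le_total i j with h | h
  · simp [symmOfUpper, h]
  · simp [symmOfUpper, h, hM.apply]

theorem symmOfUpper_isSymm {n : ℕ} {R : Type*} (x : UpperIndex n → R) :
    (symmOfUpper x).IsSymm := by
  ext i j
  simp [symmOfUpper, min_comm, max_comm]

theorem symmOfUpper_add {n : ℕ} {R : Type*} [Add R] (x y : UpperIndex n → R) :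
    symmOfUpper (x + y) = symmOfUpper x + symmOfUpper y := rfl

theorem symmOfUpper_map {n : ℕ} {R S : Type*} (f : R → S) (x : UpperIndex n → R) :
    (symmOfUpper x).map f = symmOfUpper (fun t => f (x t)) := rfl

/-- Over a commutative ring, symmetric matrices map a vector with an invertible coordinate onto
every vector. -/
theorem exists_symmOfUpper_mulVec_eq {n : ℕ} {R : Type*} [CommRing R] {u : Fin n → R} {i : Fin n}
    (hu : IsUnit (u i)) (y : Fin n → R) : ∃ x : UpperIndex n → R, symmOfUpper x *ᵥ u = y := by
  obtain ⟨c, hc⟩ := hu.exists_left_inv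
  set e : Fin n → R := Pi.single i c with he
  have heu : e ⬝ᵥ u = 1 := by rw [he, single_dotProduct, hc]
  -- As `e·u = 1`, the first term sends `u` to `y`; the second makes the matrix symmetric and adds
  -- `(y·u)e`, which the third cancels.
  set M : Matrix (Fin n) (Fin n) R := Matrix.vecMulVec y e + Matrix.vecMulVec e y -
    (y ⬝ᵥ u) • Matrix.vecMulVec e e with hMdef
  have hM : M.IsSymm := by
    ext a b
    simp only [hMdef, Matrix.transpose_apply, Matrix.sub_apply, Matrix.add_apply,
      Matrix.smul_apply, Matrix.vecMulVec_apply, smul_eq_mul]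
    ring
  refine ⟨fun t => M t.1.1 t.1.2, ?_⟩
  rw [symmOfUpper_upper hM]
  ext a
  simp only [hMdef, Matrix.sub_mulVec, Matrix.add_mulVec, Matrix.smul_mulVec,
    Matrix.vecMulVec_mulVec, heu, Pi.sub_apply, Pi.add_apply, Pi.smul_apply, smul_eq_mul,
    MulOpposite.smul_eq_mul_unop, MulOpposite.unop_op]
  ring

/-! ### Density of isotropic eigenvectors modulo `p²` -/

section ModPrimeSquare

variable (p : ℕ)

/-- Reduction of residues modulo `p ^ 2` to residues modulo `p`. -/
def reduceModPrime : ZMod (p ^ 2) →+* ZMod p :=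
  ZMod.castHom (dvd_pow_self p two_ne_zero) (ZMod p)

variable {p}

theorem reduceModPrime_surjective : Function.Surjective (reduceModPrime p) :=
  ZMod.ringHom_surjective _

/-- The vectors orthogonal to `u` and parallel to `u` modulo `p`. For isotropic `u` this is the
image modulo `p ^ 2` of the multiple by `p` of the `p`-neighbour lattice attached to `u`. -/
def neighbourSubgroup {n : ℕ} (u : Fin n → ZMod (p ^ 2)) :
    AddSubgroup (Fin n → ZMod (p ^ 2)) where
  carrier := {y | u ⬝ᵥ y = 0 ∧
    ∃ l : ZMod p, ∀ i, reduceModPrime p (y i) = l * reduceModPrime p (u i)}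
  zero_mem' := ⟨by simp, 0, by simp⟩
  add_mem' := by
    rintro y z ⟨hy, l, hl⟩ ⟨hz, m, hm⟩
    refine ⟨by rw [dotProduct_add, hy, hz, add_zero], l + m, fun i => ?_⟩
    rw [Pi.add_apply, map_add, hl, hm, add_mul]
  neg_mem' := by
    rintro y ⟨hy, l, hl⟩
    refine ⟨by rw [dotProduct_neg, hy, neg_zero], -l, fun i => ?_⟩
    rw [Pi.neg_apply, map_neg, hl, neg_mul]

/-- `x` is (the upper triangle of) a symmetric matrix modulo `p ^ 2` having a vector `u` over `w`
which is isotropic for the standard form and for the matrix and is an eigenvector modulo `p`. -/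
def HasIsotropicEigenvector {n : ℕ} (w : Fin n → ZMod p) (x : UpperIndex n → ZMod (p ^ 2)) :
    Prop :=
  ∃ u : Fin n → ZMod (p ^ 2), (∀ i, reduceModPrime p (u i) = w i) ∧ u ⬝ᵥ u = 0 ∧
    u ⬝ᵥ (symmOfUpper x *ᵥ u) = 0 ∧
    ∃ l : ZMod p, ∀ i, reduceModPrime p ((symmOfUpper x *ᵥ u) i) = l * w i

variable (p) in
/-- Symmetric matrices modulo `p ^ 2` with a nonzero isotropic eigenvector. -/
def isotropicEigenvectorSet (n : ℕ) : Set (UpperIndex n → ZMod (p ^ 2)) :=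
  {x | ∃ w : Fin n → ZMod p, w ≠ 0 ∧ HasIsotropicEigenvector w x}

variable [Fact p.Prime]

theorem reduceModPrime_eq_zero {r : ZMod (p ^ 2)} (h : reduceModPrime p r = 0) :
    ∃ s, r = p * s := by
  obtain ⟨z, rfl⟩ := ZMod.intCast_surjective r
  rw [map_intCast, ZMod.intCast_zmod_eq_zero_iff_dvd] at h
  obtain ⟨t, rfl⟩ := h
  exact ⟨t, by push_cast; rfl⟩

theorem prime_mul_eq_zero_iff {s : ZMod (p ^ 2)} :
    (p : ZMod (p ^ 2)) * s = 0 ↔ reduceModPrime p s = 0 := by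
  have hp : (p : ℤ) ≠ 0 := by exact_mod_cast (Fact.out : p.Prime).ne_zero
  have : NeZero (p ^ 2) := ⟨pow_ne_zero _ (Fact.out : p.Prime).ne_zero⟩
  obtain ⟨z, rfl⟩ := ZMod.intCast_surjective s
  rw [map_intCast, ZMod.intCast_zmod_eq_zero_iff_dvd,
    show (p : ZMod (p ^ 2)) * (z : ZMod (p ^ 2)) = ((p * z : ℤ) : ZMod (p ^ 2)) by push_cast; rfl,
    ZMod.intCast_zmod_eq_zero_iff_dvd]
  push_cast
  rw [sq, mul_dvd_mul_iff_left hp]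

theorem isUnit_of_reduceModPrime_ne_zero {r : ZMod (p ^ 2)} (h : reduceModPrime p r ≠ 0) :
    IsUnit r := by
  have hp : p.Prime := Fact.out
  have : NeZero (p ^ 2) := ⟨pow_ne_zero _ hp.ne_zero⟩
  obtain ⟨z, rfl⟩ := ZMod.natCast_zmod_surjective r
  rw [map_natCast, Ne, ZMod.natCast_eq_zero_iff] at h
  rw [ZMod.isUnit_iff_coprime]
  exact (((Nat.Prime.coprime_iff_not_dvd hp).mpr h).symm).pow_right 2

theorem reduceModPrime_dotProduct {n : ℕ} (u v : Fin n → ZMod (p ^ 2)) :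
    reduceModPrime p (u ⬝ᵥ v) =
      (fun i => reduceModPrime p (u i)) ⬝ᵥ fun i => reduceModPrime p (v i) := by
  simp [dotProduct]

/-- Two vectors with the same reduction differ by a multiple of `p`. -/
theorem exists_eq_add_prime_smul {n : ℕ} {y z : Fin n → ZMod (p ^ 2)}
    (h : ∀ i, reduceModPrime p (y i) = reduceModPrime p (z i)) :
    ∃ v, y = z + (p : ZMod (p ^ 2)) • v := by
  have h' : ∀ i, ∃ s, y i - z i = p * s := fun i =>
    reduceModPrime_eq_zero (by rw [map_sub, h, sub_self])
  choose v hv using h'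
  refine ⟨v, ?_⟩
  ext i
  simp only [Pi.add_apply, Pi.smul_apply, smul_eq_mul, ← hv]
  ring

/-- An element is `l u + p v`, with `p` choices for `l`, and only `v` mod `p` matters. Since `u·u =
0`, orthogonality to `u` becomes `u·v ≡ 0` mod `p`, which determines `v i` from the other
coordinates: `p · pⁿ⁻¹` elements at most. -/
theorem card_neighbourSubgroup_le {n : ℕ} {u : Fin n → ZMod (p ^ 2)} {i : Fin n}
    (hi : reduceModPrime p (u i) ≠ 0) (huu : u ⬝ᵥ u = 0) :
    Nat.card (neighbourSubgroup u) ≤ p ^ n := by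
  have hp : p.Prime := Fact.out
  have key : ∀ y : neighbourSubgroup u, ∃ (l : ZMod p) (v : Fin n → ZMod (p ^ 2)),
      (y : Fin n → ZMod (p ^ 2)) = (l.val : ZMod (p ^ 2)) • u + (p : ZMod (p ^ 2)) • v := by
    rintro ⟨y, hy, l, hl⟩
    refine ⟨l, exists_eq_add_prime_smul fun i => ?_⟩
    simp [hl]
  choose l v hlv using key
  have horth : ∀ y, ∑ j, reduceModPrime p (u j) * reduceModPrime p (v y j) = 0 := by
    intro y
    have h0 : u ⬝ᵥ (y : Fin n → ZMod (p ^ 2)) = 0 := y.2.1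
    rw [hlv y, dotProduct_add, dotProduct_smul, huu, smul_zero, zero_add, dotProduct_smul,
      smul_eq_mul, prime_mul_eq_zero_iff, reduceModPrime_dotProduct] at h0
    exact h0
  have hinj : Function.Injective fun y : neighbourSubgroup u =>
      (l y, fun j : {j : Fin n // j ≠ i} => reduceModPrime p (v y j)) := by
    intro y z hyz
    obtain ⟨h1, h2⟩ := Prod.ext_iff.mp hyz
    have hne : ∀ j, j ≠ i → reduceModPrime p (v y j) = reduceModPrime p (v z j) := fun j hj =>
      congrFun h2 ⟨j, hj⟩
    have hall : ∀ j, reduceModPrime p (v y j - v z j) = 0 := by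
      intro j
      by_cases hj : j = i
      · subst hj
        have hs : ∑ k, reduceModPrime p (u k) * reduceModPrime p (v y k - v z k) = 0 := by
          simp_rw [map_sub, mul_sub, Finset.sum_sub_distrib, horth, sub_zero]
        rw [Finset.sum_eq_single j (fun k _ hk => by rw [map_sub, hne k hk, sub_self, mul_zero])
          (by simp)] at hs
        exact (mul_eq_zero.mp hs).resolve_left hi
      · rw [map_sub, hne j hj, sub_self]
    apply Subtype.ext
    rw [hlv y, hlv z, show l y = l z from h1]
    congr 1
    ext j
    rw [← sub_eq_zero, Pi.smul_apply, Pi.smul_apply, smul_eq_mul, smul_eq_mul, ← mul_sub,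
      prime_mul_eq_zero_iff]
    exact hall j
  have hcard := Nat.card_le_card_of_injective _ hinj
  refine hcard.trans (le_of_eq ?_)
  have hn : 0 < n := i.pos
  simp only [Nat.card_eq_fintype_card, Fintype.card_prod, Fintype.card_fun, ZMod.card,
    Fintype.card_subtype_compl, Fintype.card_fin, Fintype.card_subtype_eq]
  rw [← pow_succ', Nat.sub_add_cancel hn]

/-- Whether `x` has an isotropic eigenvector over `w` may be tested on any isotropic lift. -/
theorem HasIsotropicEigenvector.mulVec_mem {n : ℕ} (hp2 : p ≠ 2) {w : Fin n → ZMod p}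
    {x : UpperIndex n → ZMod (p ^ 2)} (h : HasIsotropicEigenvector w x)
    {u : Fin n → ZMod (p ^ 2)} (huw : ∀ i, reduceModPrime p (u i) = w i) (huu : u ⬝ᵥ u = 0) :
    symmOfUpper x *ᵥ u ∈ neighbourSubgroup u := by
  have hp : p.Prime := Fact.out
  obtain ⟨u', hw', huu', hq', l, hl⟩ := h
  set M := symmOfUpper x with hM
  have hsymm : ∀ a b : Fin n → ZMod (p ^ 2), a ⬝ᵥ (M *ᵥ b) = b ⬝ᵥ (M *ᵥ a) := by
    intro a b
    rw [Matrix.dotProduct_mulVec, ← Matrix.mulVec_transpose,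
      (symmOfUpper_isSymm x : M.IsSymm).eq, dotProduct_comm]
  obtain ⟨v, rfl⟩ := exists_eq_add_prime_smul (y := u') (z := u) fun i => by rw [hw', huw]
  have hpp : (p : ZMod (p ^ 2)) * p = 0 := by
    rw [← sq]; exact_mod_cast ZMod.natCast_self (p ^ 2)
  have htwo : IsUnit (2 : ZMod (p ^ 2)) := by
    apply isUnit_of_reduceModPrime_ne_zero
    rw [map_ofNat]
    intro h2
    have : ((2 : ℕ) : ZMod p) = 0 := by exact_mod_cast h2
    rw [ZMod.natCast_eq_zero_iff] at this
    exact hp2 ((Nat.prime_dvd_prime_iff_eq hp Nat.prime_two).mp this)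
  -- Expanding `(u + pv)·(u + pv) = 0` leaves `2p(u·v) = 0`; this is where `p` must be odd.
  have huv : (p : ZMod (p ^ 2)) * (u ⬝ᵥ v) = 0 := by
    simp only [add_dotProduct, dotProduct_add, smul_dotProduct, dotProduct_smul, smul_eq_mul,
      huu, dotProduct_comm v u] at huu'
    have h2 : (2 : ZMod (p ^ 2)) * ((p : ZMod (p ^ 2)) * (u ⬝ᵥ v)) = 0 := by
      linear_combination huu' - (v ⬝ᵥ v) * hpp
    exact (htwo.mul_right_eq_zero).mp h2
  have hred : ∀ i, reduceModPrime p ((M *ᵥ u) i) = l * reduceModPrime p (u i) := by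
    intro i
    have hi := hl i
    rw [Matrix.mulVec_add, Matrix.mulVec_smul, Pi.add_apply, Pi.smul_apply, smul_eq_mul, map_add,
      map_mul, map_natCast, CharP.cast_eq_zero, zero_mul, add_zero] at hi
    rw [hi, huw]
  refine ⟨?_, l, hred⟩
  obtain ⟨c, hc⟩ := reduceModPrime_surjective l
  obtain ⟨d, hd⟩ := exists_eq_add_prime_smul (y := M *ᵥ u) (z := c • u) fun i => by
    rw [hred, Pi.smul_apply, smul_eq_mul, map_mul, hc]
  -- `M u = c u + p d` by the eigenvector condition, so the cross term reduces to `c p (u·v)`,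
  -- already known to vanish.
  have hvMu : (p : ZMod (p ^ 2)) * (v ⬝ᵥ (M *ᵥ u)) = 0 := by
    rw [hd, dotProduct_add, dotProduct_smul, dotProduct_smul, smul_eq_mul, smul_eq_mul,
      dotProduct_comm v u]
    linear_combination c * huv + (v ⬝ᵥ d) * hpp
  simp only [Matrix.mulVec_add, Matrix.mulVec_smul, add_dotProduct, dotProduct_add,
    smul_dotProduct, dotProduct_smul, smul_eq_mul, hsymm u v] at hq'
  linear_combination hq' - 2 * hvMu - (v ⬝ᵥ (M *ᵥ v)) * hpp

/-- Fix one isotropic lift `u` of `w`. The additive map `x ↦ symmOfUpper x *ᵥ u` is onto, and all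
good `x` land in `neighbourSubgroup u`, of index at least `p²ⁿ / pⁿ = pⁿ`. -/
theorem card_hasIsotropicEigenvector_le {n : ℕ} (hp2 : p ≠ 2) {w : Fin n → ZMod p} (hw : w ≠ 0) :
    {x : UpperIndex n → ZMod (p ^ 2) | HasIsotropicEigenvector w x}.ncard * p ^ n ≤
      (p ^ 2) ^ Fintype.card (UpperIndex n) := by
  have hp : p.Prime := Fact.out
  have : NeZero (p ^ 2) := ⟨pow_ne_zero _ hp.ne_zero⟩
  rcases Set.eq_empty_or_nonempty
    {x : UpperIndex n → ZMod (p ^ 2) | HasIsotropicEigenvector w x} with h0 | ⟨x₀, hx₀⟩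
  · simp [h0]
  obtain ⟨u, huw, huu, -⟩ := hx₀
  obtain ⟨i, hi⟩ := Function.ne_iff.mp hw
  have hui : reduceModPrime p (u i) ≠ 0 := by rw [huw]; exact hi
  let φ : (UpperIndex n → ZMod (p ^ 2)) →+ (Fin n → ZMod (p ^ 2)) :=
    AddMonoidHom.mk' (fun x => symmOfUpper x *ᵥ u) fun x y => by
      rw [symmOfUpper_add, Matrix.add_mulVec]
  have hφ : Function.Surjective φ := fun y =>
    exists_symmOfUpper_mulVec_eq (isUnit_of_reduceModPrime_ne_zero hui) y
  have hsub : {x : UpperIndex n → ZMod (p ^ 2) | HasIsotropicEigenvector w x} ⊆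
      ((neighbourSubgroup u).comap φ : Set (UpperIndex n → ZMod (p ^ 2))) :=
    fun x hx => HasIsotropicEigenvector.mulVec_mem hp2 hx huw huu
  have h1 : {x : UpperIndex n → ZMod (p ^ 2) | HasIsotropicEigenvector w x}.ncard ≤
      Nat.card ((neighbourSubgroup u).comap φ) :=
    Set.ncard_le_ncard hsub (Set.toFinite _)
  have h2 := ((neighbourSubgroup u).comap φ).card_mul_index
  rw [AddSubgroup.index_comap_of_surjective _ hφ] at h2
  have h3 := (neighbourSubgroup u).card_mul_index
  have h4 := card_neighbourSubgroup_le hui huu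
  simp only [Nat.card_eq_fintype_card (α := Fin n → ZMod (p ^ 2)),
    Nat.card_eq_fintype_card (α := UpperIndex n → ZMod (p ^ 2)), Fintype.card_fun, ZMod.card,
    Fintype.card_fin] at h2 h3
  have h5 : p ^ n ≤ (neighbourSubgroup u).index := by
    have hpos : 0 < p ^ n := pow_pos hp.pos n
    refine Nat.le_of_mul_le_mul_left ?_ hpos
    calc p ^ n * p ^ n = (p ^ 2) ^ n := by rw [← pow_add, ← pow_mul]; congr 1; ring
      _ = Nat.card (neighbourSubgroup u) * (neighbourSubgroup u).index := h3.symm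
      _ ≤ p ^ n * (neighbourSubgroup u).index := Nat.mul_le_mul_right _ h4
  calc _ ≤ Nat.card ((neighbourSubgroup u).comap φ) * (neighbourSubgroup u).index :=
        Nat.mul_le_mul h1 h5
    _ = _ := h2

/-- There are at most `2 q ^ m` isotropic vectors in dimension `m + 1` over a field with `q`
elements. -/
theorem card_isotropic_le (m : ℕ) (F : Type*) [Field F] [Fintype F] [DecidableEq F] :
    (Finset.univ.filter fun w : Fin (m + 1) → F => w ⬝ᵥ w = 0).card ≤
      2 * Fintype.card F ^ m := by
  have h := Finset.card_le_mul_card_image_of_maps_to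
    (s := Finset.univ.filter fun w : Fin (m + 1) → F => w ⬝ᵥ w = 0)
    (t := (Finset.univ : Finset (Fin m → F))) (f := Fin.tail) (fun _ _ => Finset.mem_univ _) 2 ?_
  · simpa using h
  intro a _
  rcases Finset.eq_empty_or_nonempty ((Finset.univ.filter
    fun w : Fin (m + 1) → F => w ⬝ᵥ w = 0).filter fun w => Fin.tail w = a) with h0 | ⟨w, hw⟩
  · rw [h0]; simp
  -- Once the tail is fixed, the square of the first coordinate is determined.
  refine (Finset.card_le_card (t := {Fin.cons (w 0) a, Fin.cons (-w 0) a}) ?_).trans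
    Finset.card_le_two
  intro z hz
  simp only [Finset.mem_filter, Finset.mem_univ, true_and, dotProduct, Fin.sum_univ_succ] at hw hz
  obtain ⟨hw0, rfl⟩ := hw
  obtain ⟨hz0, hz1⟩ := hz
  have htail : ∀ i, z (Fin.succ i) = w (Fin.succ i) := fun i => congrFun hz1 i
  simp_rw [htail] at hz0
  have hsq : z 0 * z 0 = w 0 * w 0 := by linear_combination hz0 - hw0
  rw [Finset.mem_insert, Finset.mem_singleton, ← hz1]
  rcases mul_self_eq_mul_self_iff.mp hsq with h | h
  · left; rw [← h, Fin.cons_self_tail]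
  · right; rw [← h, Fin.cons_self_tail]

/-- Eigenvectors come in whole lines, which gains the factor `p - 1` in the double count. -/
theorem HasIsotropicEigenvector.smul {n : ℕ} {w : Fin n → ZMod p}
    {x : UpperIndex n → ZMod (p ^ 2)} (h : HasIsotropicEigenvector w x) (c : ZMod p) :
    HasIsotropicEigenvector (c • w) x := by
  obtain ⟨u, hw, huu, hq, l, hl⟩ := h
  obtain ⟨d, rfl⟩ := reduceModPrime_surjective c
  refine ⟨d • u, fun i => by simp [hw], by simp [huu], by simp [Matrix.mulVec_smul, hq], l,
    fun i => ?_⟩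
  simp only [Matrix.mulVec_smul, Pi.smul_apply, smul_eq_mul, map_mul, hl]
  ring

theorem HasIsotropicEigenvector.dotProduct_self {n : ℕ} {w : Fin n → ZMod p}
    {x : UpperIndex n → ZMod (p ^ 2)} (h : HasIsotropicEigenvector w x) : w ⬝ᵥ w = 0 := by
  obtain ⟨u, hw, huu, -⟩ := h
  rw [← funext hw, ← reduceModPrime_dotProduct, huu, map_zero]

/-- Double counting of pairs `(x, w)`: each `x` has at least the `p - 1` unit multiples of one `w`,
and each of the at most `2pᵐ` isotropic `w` serves at most a fraction `p⁻⁽ᵐ⁺¹⁾` of all `x`. -/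
theorem ncard_isotropicEigenvectorSet_le (m : ℕ) (hp2 : p ≠ 2) :
    (isotropicEigenvectorSet p (m + 1)).ncard * (p - 1) * p ≤
      2 * (p ^ 2) ^ Fintype.card (UpperIndex (m + 1)) := by
  classical
  have hp : p.Prime := Fact.out
  have : NeZero (p ^ 2) := ⟨pow_ne_zero _ hp.ne_zero⟩
  set C := (p ^ 2) ^ Fintype.card (UpperIndex (m + 1)) with hC
  set t := Finset.univ.filter fun w : Fin (m + 1) → ZMod p => w ≠ 0 ∧ w ⬝ᵥ w = 0 with ht
  have hdc := Finset.card_mul_le_card_mul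
    (s := (isotropicEigenvectorSet p (m + 1)).toFinset) (t := t)
    (m := p - 1) (n := C / p ^ (m + 1)) (fun x w => HasIsotropicEigenvector w x) ?_ ?_
  · have ht2 : t.card ≤ 2 * p ^ m := by
      refine (Finset.card_le_card ?_).trans ((card_isotropic_le m (ZMod p)).trans (by simp))
      intro w hw
      simp only [ht, Finset.mem_filter] at hw ⊢
      exact ⟨hw.1, hw.2.2⟩
    rw [← Set.ncard_eq_toFinset_card'] at hdc
    have hpm : 0 < p ^ m := pow_pos hp.pos m
    refine Nat.le_of_mul_le_mul_left ?_ hpm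
    calc p ^ m * ((isotropicEigenvectorSet p (m + 1)).ncard * (p - 1) * p)
        = (isotropicEigenvectorSet p (m + 1)).ncard * (p - 1) * p ^ (m + 1) := by ring
      _ ≤ t.card * (C / p ^ (m + 1)) * p ^ (m + 1) := Nat.mul_le_mul_right _ hdc
      _ = t.card * (C / p ^ (m + 1) * p ^ (m + 1)) := by ring
      _ ≤ (2 * p ^ m) * C := Nat.mul_le_mul ht2 (Nat.div_mul_le_self _ _)
      _ = p ^ m * (2 * C) := by ring
  · intro x hx
    rw [Set.mem_toFinset] at hx
    obtain ⟨w, hw, hxw⟩ := hx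
    have hinj : Function.Injective fun c : (ZMod p)ˣ => (c : ZMod p) • w := by
      intro c d hcd
      obtain ⟨i, hi⟩ := Function.ne_iff.mp hw
      have := congrFun hcd i
      exact Units.ext (mul_right_cancel₀ hi this)
    calc p - 1 = (Finset.univ.image fun c : (ZMod p)ˣ => (c : ZMod p) • w).card := by
          rw [Finset.card_image_of_injective _ hinj, Finset.card_univ, ZMod.card_units]
      _ ≤ _ := by
          apply Finset.card_le_card
          intro z hz
          obtain ⟨c, -, rfl⟩ := Finset.mem_image.mp hz
          have hs := hxw.smul (c : ZMod p)
          rw [Finset.mem_bipartiteAbove, ht, Finset.mem_filter]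
          exact ⟨⟨Finset.mem_univ _, smul_ne_zero c.ne_zero hw, hs.dotProduct_self⟩, hs⟩
  · intro w hw
    simp only [ht, Finset.mem_filter] at hw
    rw [Nat.le_div_iff_mul_le (pow_pos hp.pos _)]
    refine le_trans (Nat.mul_le_mul_right _ ?_) (card_hasIsotropicEigenvector_le hp2 hw.2.1)
    rw [← Set.ncard_coe_finset]
    refine Set.ncard_le_ncard ?_ (Set.toFinite _)
    intro x hx
    simp only [Finset.mem_coe, Finset.mem_bipartiteBelow] at hx
    exact hx.2

theorem density_isotropicEigenvectorSet_le {n : ℕ} (hn : 1 ≤ n) (hp2 : p ≠ 2) :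
    ((isotropicEigenvectorSet p n).ncard : ℝ) /
      ((p ^ 2 : ℕ) : ℝ) ^ Fintype.card (UpperIndex n) ≤ 3 / (p : ℝ) ^ 2 := by
  have hp : p.Prime := Fact.out
  obtain ⟨m, rfl⟩ := Nat.exists_eq_add_of_le' hn
  have h3 : 3 ≤ p := by
    have := hp.two_le
    omega
  have h3R : (3 : ℝ) ≤ p := by exact_mod_cast h3
  have h := (Nat.cast_le (α := ℝ)).mpr (ncard_isotropicEigenvectorSet_le (p := p) m hp2)
  rw [Nat.cast_mul, Nat.cast_mul, Nat.cast_mul, Nat.cast_sub hp.one_le, Nat.cast_pow,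
    Nat.cast_one, Nat.cast_ofNat] at h
  set a : ℝ := ((isotropicEigenvectorSet p (m + 1)).ncard : ℝ)
  set C : ℝ := ((p ^ 2 : ℕ) : ℝ) ^ Fintype.card (UpperIndex (m + 1))
  have hCpos : 0 < C := by
    have : (0 : ℝ) < ((p ^ 2 : ℕ) : ℝ) := by push_cast; positivity
    positivity
  have ha : 0 ≤ a := Nat.cast_nonneg _
  rw [div_le_div_iff₀ hCpos (by positivity)]
  -- `2p² ≤ 3p(p-1)` is equivalent to `p ≥ 3`.
  have h2 : a * (p : ℝ) ^ 2 * 2 ≤ a * (p - 1) * p * 3 := by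
    have : 0 ≤ a * p * (p - 3) := by
      apply mul_nonneg (by positivity); linarith
    nlinarith
  linarith

end ModPrimeSquare

/-! ### From rational orthogonal matrices to isotropic eigenvectors -/

theorem isIntegerMatrix_iff {n : ℕ} {A : Matrix (Fin n) (Fin n) ℚ} :
    IsIntegerMatrix A ↔ ∃ B : Matrix (Fin n) (Fin n) ℤ, B.map (Int.cast : ℤ → ℚ) = A := by
  constructor
  · intro h
    choose B hB using h
    exact ⟨Matrix.of B, by ext i j; simp [hB]⟩
  · rintro ⟨B, rfl⟩ i j
    exact ⟨B i j, rfl⟩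

theorem matrix_intCast_map_mul {n : ℕ} {R : Type*} [Ring R] (A B : Matrix (Fin n) (Fin n) ℤ) :
    (A * B).map (Int.cast : ℤ → R) = A.map Int.cast * B.map Int.cast :=
  Matrix.map_mul (f := Int.castRingHom R)

theorem matrix_intCast_map_injective {n : ℕ} :
    Function.Injective fun A : Matrix (Fin n) (Fin n) ℤ => A.map (Int.cast : ℤ → ℚ) :=
  Matrix.map_injective Int.cast_injective

/-- The integer data carried by a rational orthogonal matrix `Q` of level `ℓ` for which
`Qᵀ X Q` is integral. -/
theorem HasIntegralConjugation.exists_integer_data {n L : ℕ} {X : Matrix (Fin n) (Fin n) ℤ}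
    (h : HasIntegralConjugation L X) :
    ∃ (ℓ : ℕ) (U Y : Matrix (Fin n) (Fin n) ℤ), 2 ≤ ℓ ∧ ℓ ≤ L ∧
      Uᵀ * U = ((ℓ : ℤ) ^ 2) • (1 : Matrix (Fin n) (Fin n) ℤ) ∧ X * U = U * Y ∧
      ∀ p, p.Prime → p ∣ ℓ → ∃ i j, ¬ (p : ℤ) ∣ U i j := by
  obtain ⟨Q, hQ, hY⟩ := h
  simp only [Set.mem_iUnion, exists_prop] at hQ
  obtain ⟨ℓ, ⟨hℓ2, hℓL⟩, hQorth, hlev⟩ := hQ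
  have hleast := isLeast_matrixLevel Q
  rw [hlev] at hleast
  obtain ⟨U, hU⟩ := isIntegerMatrix_iff.mp hleast.1.2
  obtain ⟨Y, hYX⟩ := isIntegerMatrix_iff.mp hY
  have hQ1 : Qᵀ * Q = 1 := by
    have := (Matrix.mem_orthogonalGroup_iff' (Fin n) ℚ).mp hQorth
    simpa [Matrix.star_eq_conjTranspose] using this
  have hQ2 : Q * Qᵀ = 1 := by
    have := (Matrix.mem_orthogonalGroup_iff (Fin n) ℚ).mp hQorth
    simpa [Matrix.star_eq_conjTranspose] using this
  refine ⟨ℓ, U, Y, hℓ2, hℓL, ?_, ?_, ?_⟩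
  · apply matrix_intCast_map_injective
    beta_reduce
    rw [matrix_intCast_map_mul, Matrix.transpose_map, hU, Matrix.transpose_smul,
      Matrix.smul_mul, Matrix.mul_smul, hQ1]
    ext i j
    simp only [Matrix.smul_apply, Matrix.map_apply, Matrix.one_apply, smul_eq_mul]
    split_ifs <;> push_cast <;> ring
  · apply matrix_intCast_map_injective
    beta_reduce
    rw [matrix_intCast_map_mul, matrix_intCast_map_mul, hU, hYX, Matrix.mul_smul,
      Matrix.smul_mul, Matrix.mul_assoc, ← Matrix.mul_assoc Q, hQ2, Matrix.one_mul]
  · intro p hp hpℓ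
    -- If `p` divided every entry of `U`, then `m = ℓ / p` would already clear the denominators of
    -- `Q`.
    by_contra! hcon
    obtain ⟨m, rfl⟩ := hpℓ
    have hm : 1 ≤ m := Nat.one_le_iff_ne_zero.mpr (by rintro rfl; omega)
    have hmem : m ∈ {ℓ : ℕ | 1 ≤ ℓ ∧ IsIntegerMatrix ((ℓ : ℚ) • Q)} := by
      refine ⟨hm, fun i j => ?_⟩
      obtain ⟨c, hc⟩ := hcon i j
      refine ⟨c, ?_⟩
      have hij := congrFun (congrFun hU i) j
      simp only [Matrix.map_apply, Matrix.smul_apply, smul_eq_mul, hc] at hij ⊢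
      push_cast at hij
      have hp0 : (p : ℚ) ≠ 0 := by exact_mod_cast hp.ne_zero
      apply mul_left_cancel₀ hp0
      rw [hij]
      ring
    have := hleast.2 hmem
    have := hp.two_le
    nlinarith

/-- A sum of at most three integer squares, one of them odd, is not divisible by four. -/
theorem not_four_dvd_sum_sq {n : ℕ} (hn : n ≤ 3) (v : Fin n → ℤ) {i : Fin n}
    (hi : ¬ (2 : ℤ) ∣ v i) : ¬ (4 : ℤ) ∣ ∑ k, v k * v k := by
  have hodd : v i * v i % 4 = 1 := by
    have := Int.sq_mod_four_eq_one_of_odd (Int.not_even_iff_odd.mp fun h => hi h.two_dvd)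
    rwa [sq] at this
  have hsq : ∀ k, v k * v k % 4 = 0 ∨ v k * v k % 4 = 1 := by
    intro k
    rcases Int.even_or_odd (v k) with h | h
    · left
      obtain ⟨c, hc⟩ := h.two_dvd
      rw [hc]
      exact Int.emod_eq_zero_of_dvd ⟨c * c, by ring⟩
    · right
      have := Int.sq_mod_four_eq_one_of_odd h
      rwa [sq] at this
  intro hdvd
  -- Each square is 0 or 1 mod 4 and one of them is 1, so the sum is 1, 2 or 3 mod 4.
  interval_cases n
  · exact i.elim0
  · fin_cases i
    simp only [Fin.sum_univ_one] at hdvd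
    simp only [Fin.zero_eta] at hodd
    omega
  · have h0 := hsq 0
    have h1 := hsq 1
    simp only [Fin.sum_univ_two] at hdvd
    fin_cases i <;> simp only [Fin.zero_eta, Fin.mk_one] at hodd <;> omega
  · have h0 := hsq 0
    have h1 := hsq 1
    have h2 := hsq 2
    simp only [Fin.sum_univ_three] at hdvd
    fin_cases i <;> simp only [Fin.zero_eta, Fin.mk_one, Fin.reduceFinMk] at hodd <;> omega

/-- A totally isotropic column space in dimension at most three is a line. -/
theorem exists_smul_mulVec_of_transpose_mul_self_eq_zero {n : ℕ} (hn : n ≤ 3) {F : Type*}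
    [Field F] {U : Matrix (Fin n) (Fin n) F} (hU : Uᵀ * U = 0) (a b : Fin n → F)
    (ha : U *ᵥ a ≠ 0) : ∃ l : F, U *ᵥ b = l • (U *ᵥ a) := by
  -- `Uᵀ U = 0` gives `2 · rank U ≤ n ≤ 3`, hence rank at most one.
  have hrank := Matrix.rank_add_rank_le_card_of_mul_eq_zero hU
  rw [Matrix.rank_transpose, Fintype.card_fin] at hrank
  have h1 : Module.finrank F (LinearMap.range U.mulVecLin) ≤ 1 := by
    change U.rank ≤ 1
    omega
  obtain ⟨v, hv⟩ := finrank_le_one_iff.mp h1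
  obtain ⟨s, hs⟩ := hv ⟨U *ᵥ a, a, rfl⟩
  obtain ⟨t, ht⟩ := hv ⟨U *ᵥ b, b, rfl⟩
  have hs' : s • (v : Fin n → F) = U *ᵥ a := congrArg Subtype.val hs
  have ht' : t • (v : Fin n → F) = U *ᵥ b := congrArg Subtype.val ht
  have hs0 : s ≠ 0 := by
    rintro rfl
    exact ha (by rw [← hs', zero_smul])
  refine ⟨t * s⁻¹, ?_⟩
  rw [← hs', ← ht', smul_smul, mul_assoc, inv_mul_cancel₀ hs0, mul_one]

/-- In dimension at most three, an integral conjugation by a rational orthogonal matrix of level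
between `2` and `L` forces an isotropic eigenvector modulo an odd prime at most `L`. -/
theorem HasIntegralConjugation.exists_mem_isotropicEigenvectorSet {n L : ℕ} (hn : n ≤ 3)
    {X : Matrix (Fin n) (Fin n) ℤ} (hX : X.IsSymm) (h : HasIntegralConjugation L X) :
    ∃ p, p.Prime ∧ p ≠ 2 ∧ p ≤ L ∧
      (fun t : UpperIndex n => (X t.1.1 t.1.2 : ZMod (p ^ 2))) ∈ isotropicEigenvectorSet p n := by
  obtain ⟨ℓ, U, Y, hℓ2, hℓL, hUU, hXU, hprim⟩ := h.exists_integer_data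
  -- Any prime factor of `ℓ` would do.
  set p := ℓ.minFac with hpdef
  have hp : p.Prime := Nat.minFac_prime (by omega)
  have hpℓ : p ∣ ℓ := ℓ.minFac_dvd
  have hFact : Fact p.Prime := ⟨hp⟩
  obtain ⟨i, j, hij⟩ := hprim p hp hpℓ
  have hdiv : ((p ^ 2 : ℕ) : ℤ) ∣ (ℓ : ℤ) ^ 2 := by
    exact_mod_cast pow_dvd_pow_of_dvd hpℓ 2
  have hcol : ∑ k, U k j * U k j = (ℓ : ℤ) ^ 2 := by
    have := congrFun (congrFun hUU j) j
    simpa [Matrix.mul_apply] using this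
  have hform : ∑ k, U k j * (X * U) k j = (ℓ : ℤ) ^ 2 * Y j j := by
    have h1 : Uᵀ * (X * U) = ((ℓ : ℤ) ^ 2) • Y := by
      rw [hXU, ← Matrix.mul_assoc, hUU, Matrix.smul_mul, Matrix.one_mul]
    have := congrFun (congrFun h1 j) j
    simpa [Matrix.mul_apply] using this
  have hred : symmOfUpper (fun t : UpperIndex n => (X t.1.1 t.1.2 : ZMod (p ^ 2))) =
      X.map Int.cast := by
    rw [← symmOfUpper_map (Int.cast : ℤ → ZMod (p ^ 2)) (fun t => X t.1.1 t.1.2),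
      symmOfUpper_upper hX]
  have hmulVec : (X.map Int.cast : Matrix (Fin n) (Fin n) (ZMod (p ^ 2))) *ᵥ
      (fun k => (U k j : ZMod (p ^ 2))) = fun k => (((X * U) k j : ℤ) : ZMod (p ^ 2)) := by
    ext k
    simp [Matrix.mulVec, dotProduct, Matrix.mul_apply]
  have hp2 : p ≠ 2 := by
    intro h2
    rw [h2] at hij hdiv
    apply not_four_dvd_sum_sq hn (fun k => U k j) hij
    rw [hcol]
    exact_mod_cast hdiv
  refine ⟨p, hp, hp2, (Nat.minFac_le (by omega)).trans hℓL, fun k => (U k j : ZMod p), ?_,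
    fun k => (U k j : ZMod (p ^ 2)), ?_, ?_, ?_, ?_⟩
  · refine Function.ne_iff.mpr ⟨i, ?_⟩
    rwa [Pi.zero_apply, Ne, ZMod.intCast_zmod_eq_zero_iff_dvd]
  · intro k
    rw [map_intCast]
  · have : ((∑ k, U k j * U k j : ℤ) : ZMod (p ^ 2)) = 0 := by
      rw [ZMod.intCast_zmod_eq_zero_iff_dvd, hcol]
      exact hdiv
    simpa [dotProduct] using this
  · rw [hred, hmulVec]
    have : ((∑ k, U k j * (X * U) k j : ℤ) : ZMod (p ^ 2)) = 0 := by
      rw [ZMod.intCast_zmod_eq_zero_iff_dvd, hform]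
      exact hdiv.mul_right _
    simpa only [dotProduct, Int.cast_sum, Int.cast_mul] using this
  · rw [hred, hmulVec]
    simp only [map_intCast]
    have hUp : (U.map Int.cast : Matrix (Fin n) (Fin n) (ZMod p))ᵀ * U.map Int.cast = 0 := by
      rw [← Matrix.transpose_map, ← matrix_intCast_map_mul, hUU]
      ext a b
      have hℓ0 : ((ℓ : ℤ) : ZMod p) = 0 := by
        rw [ZMod.intCast_zmod_eq_zero_iff_dvd]; exact_mod_cast hpℓ
      rw [Matrix.map_apply, Matrix.smul_apply, smul_eq_mul, Int.cast_mul, Int.cast_pow, hℓ0]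
      simp
    have hUj : (U.map Int.cast : Matrix (Fin n) (Fin n) (ZMod p)) *ᵥ Pi.single j 1 =
        fun k => (U k j : ZMod p) := by
      ext k
      simp
    have hXUj : (U.map Int.cast : Matrix (Fin n) (Fin n) (ZMod p)) *ᵥ
        (fun k => (Y k j : ZMod p)) = fun k => (((X * U) k j : ℤ) : ZMod p) := by
      ext k
      rw [hXU]
      simp [Matrix.mulVec, dotProduct, Matrix.mul_apply]
    -- Column `j` of `X U = U Y` is `U` applied to column `j` of `Y`, so mod `p` it lies on the line
    -- spanned by column `j` of `U`.
    obtain ⟨l, hl⟩ := exists_smul_mulVec_of_transpose_mul_self_eq_zero hn hUp (Pi.single j 1)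
      (fun k => (Y k j : ZMod p)) (by
        rw [hUj]
        refine Function.ne_iff.mpr ⟨i, ?_⟩
        rwa [Pi.zero_apply, Ne, ZMod.intCast_zmod_eq_zero_iff_dvd])
    rw [hUj, hXUj] at hl
    exact ⟨l, fun k => congrFun hl k⟩

/-! ### Periodicity in the matrix entries -/

/-- Having an integral conjugation of level at most `L` depends only on the matrix modulo
`(L !) ^ 2`. -/
theorem HasIntegralConjugation.congr {n L : ℕ} {X X' : Matrix (Fin n) (Fin n) ℤ}
    (h : HasIntegralConjugation L X)
    (hXX' : ∀ i j, (X i j : ZMod (L.factorial ^ 2)) = X' i j) : HasIntegralConjugation L X' := by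
  obtain ⟨Q, hQ, hY⟩ := h
  refine ⟨Q, hQ, ?_⟩
  simp only [Set.mem_iUnion, exists_prop] at hQ
  obtain ⟨ℓ, ⟨hℓ2, hℓL⟩, -, hlev⟩ := hQ
  have hleast := (isLeast_matrixLevel Q).1
  rw [hlev] at hleast
  obtain ⟨U, hU⟩ := isIntegerMatrix_iff.mp hleast.2
  obtain ⟨Y, hYX⟩ := isIntegerMatrix_iff.mp hY
  obtain ⟨c, hc⟩ := Nat.dvd_factorial (by omega : 0 < ℓ) hℓL
  have hZ : ∀ i j, ∃ z : ℤ, X' i j = X i j + ((L.factorial : ℤ) ^ 2) * z := by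
    intro i j
    have := (ZMod.intCast_eq_intCast_iff_dvd_sub _ _ _).mp (hXX' i j)
    obtain ⟨z, hz⟩ := this
    push_cast at hz
    exact ⟨z, by rw [← hz]; ring⟩
  choose Z hZ using hZ
  have hX' : X'.map (Int.cast : ℤ → ℚ) = X.map Int.cast +
      ((ℓ : ℚ) * (ℓ : ℚ) * (c : ℚ) ^ 2) • (Matrix.of Z).map Int.cast := by
    ext i j
    simp only [Matrix.map_apply, hZ, hc, Matrix.add_apply, Matrix.smul_apply, Matrix.of_apply,
      smul_eq_mul]
    push_cast
    ring
  rw [isIntegerMatrix_iff]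
  -- With `L! = ℓc` and `X' = X + (L!)² Z`, the change in `Qᵀ X Q` is `(ℓc)² Qᵀ Z Q = c² Uᵀ Z U`.
  refine ⟨Y + ((c : ℤ) ^ 2) • (Uᵀ * Matrix.of Z * U), ?_⟩
  have hmap : (((c : ℤ) ^ 2) • (Uᵀ * Matrix.of Z * U)).map (Int.cast : ℤ → ℚ) =
      ((c : ℚ) ^ 2) • ((Uᵀ * Matrix.of Z * U).map Int.cast) := by
    ext i j
    simp only [Matrix.map_apply, Matrix.smul_apply, smul_eq_mul]
    push_cast
    rfl
  rw [Matrix.map_add _ Int.cast_add, hYX, hmap, matrix_intCast_map_mul, matrix_intCast_map_mul,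
    Matrix.transpose_map, hU, hX', Matrix.mul_add, Matrix.add_mul]
  congr 1
  simp only [Matrix.transpose_smul, Matrix.smul_mul, Matrix.mul_smul, smul_smul]
  congr 1
  ring

/-! ### Summation over odd primes and conclusion -/

/-- Telescoping, from `(2t+3)² ≥ 4(t+1)(t+2)`. -/
theorem sum_three_div_odd_sq_le (T : ℕ) :
    ∑ t ∈ Finset.range T, (3 : ℝ) / (2 * t + 3) ^ 2 ≤ 3 / 4 * (1 - 1 / ((T : ℝ) + 1)) := by
  induction T with
  | zero => simp
  | succ T ih =>
    rw [Finset.sum_range_succ]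
    have hT : (0 : ℝ) ≤ T := Nat.cast_nonneg T
    have h : (3 : ℝ) / (2 * T + 3) ^ 2 ≤ 3 / 4 * (1 / (T + 1) - 1 / (T + 2)) := by
      rw [show (1 : ℝ) / (T + 1) - 1 / (T + 2) = 1 / ((T + 1) * (T + 2)) by field_simp; ring,
        div_mul_div_comm, div_le_div_iff₀ (by positivity) (by positivity)]
      nlinarith
    push_cast
    rw [show (T : ℝ) + 1 + 1 = T + 2 by ring]
    linarith

theorem sum_three_div_odd_prime_sq_le (L : ℕ) :
    ∑ p ∈ (Finset.range (L + 1)).filter (fun p => p.Prime ∧ p ≠ 2), (3 : ℝ) / (p : ℝ) ^ 2 ≤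
      3 / 4 := by
  have hsub : (Finset.range (L + 1)).filter (fun p => p.Prime ∧ p ≠ 2) ⊆
      (Finset.range L).image fun t => 2 * t + 3 := by
    intro p hp
    simp only [Finset.mem_filter, Finset.mem_range] at hp
    obtain ⟨hpL, hp, hp2⟩ := hp
    obtain ⟨s, hs⟩ := hp.odd_of_ne_two hp2
    have := hp.two_le
    simp only [Finset.mem_image, Finset.mem_range]
    exact ⟨s - 1, by omega, by omega⟩
  refine (Finset.sum_le_sum_of_subset_of_nonneg hsub fun _ _ _ => by positivity).trans ?_
  rw [Finset.sum_image fun a _ b _ h => by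
    have h' : 2 * a + 3 = 2 * b + 3 := h
    omega]
  push_cast
  refine (sum_three_div_odd_sq_le L).trans ?_
  have : (0 : ℝ) ≤ 1 / ((L : ℝ) + 1) := by positivity
  linarith

theorem corollary4 (n : ℕ) (hn : 1 ≤ n) (hn3 : n ≤ 3)
    (Ω : ℕ → Type*) [∀ k, MeasurableSpace (Ω k)]
    (P : ∀ k, Measure (Ω k)) [∀ k, IsProbabilityMeasure (P k)]
    (X : ∀ k, Ω k → Matrix (Fin n) (Fin n) ℤ)
    (hX : ∀ k, 1 ≤ k → IsUniformSymmetricMatrix (P k) k (X k)) :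
    ∃ (p : ℕ → ℝ) (q : ℝ),
      (∀ L, Tendsto (fun k => (P k).real {ω | HasIntegralConjugation L (X k ω)})
        atTop (𝓝 (p L))) ∧
      Tendsto p atTop (𝓝 q) ∧ q < 1 := by
  have hres : ∀ (N : ℕ) [NeZero N] (A : Set (UpperIndex n → ZMod N)),
      Tendsto (fun k => (P k).real {ω | (fun t : UpperIndex n =>
        (X k ω t.1.1 t.1.2 : ZMod N)) ∈ A}) atTop
        (𝓝 ((A.ncard : ℝ) / (N : ℝ) ^ Fintype.card (UpperIndex n))) := by
    intro N _ A
    have hind : ∀ k, 1 ≤ k →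
        iIndepFun (fun (t : UpperIndex n) ω => X k ω t.1.1 t.1.2) (P k) := fun k hk =>
      (hX k hk).indep
    have hlaw : ∀ k, 1 ≤ k → ∀ t : UpperIndex n, HasLaw (fun ω => X k ω t.1.1 t.1.2)
        (uniformOn (Set.Icc (1 : ℤ) k)) (P k) := fun k hk t => (hX k hk).uniform _ _ t.2
    exact tendsto_measureReal_residues N Ω P (fun k ω (t : UpperIndex n) => X k ω t.1.1 t.1.2)
      hind hlaw A
  have hex : ∀ L, ∃ c, Tendsto (fun k => (P k).real {ω | HasIntegralConjugation L (X k ω)})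
      atTop (𝓝 c) := by
    intro L
    have : NeZero (L.factorial ^ 2) := ⟨pow_ne_zero _ L.factorial_ne_zero⟩
    -- Residue vectors with some good integer lift; by `HasIntegralConjugation.congr` every
    -- symmetric lift is then good.
    refine ⟨_, (hres (L.factorial ^ 2) {a | ∃ x : UpperIndex n → ℤ,
      (fun t => (x t : ZMod (L.factorial ^ 2))) = a ∧
        HasIntegralConjugation L (symmOfUpper x)}).congr' ?_⟩
    filter_upwards [eventually_ge_atTop 1] with k hk
    congr 1
    ext ω
    have hsymm := (hX k hk).isSymm ω
    constructor
    · rintro ⟨x, hx, h⟩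
      refine h.congr fun i j => ?_
      rw [← symmOfUpper_upper hsymm]
      exact congrFun hx _
    · intro h
      exact ⟨fun t => X k ω t.1.1 t.1.2, rfl, by rwa [symmOfUpper_upper hsymm]⟩
  choose p hp using hex
  have hmono : Monotone p := by
    intro L L' hLL'
    refine le_of_tendsto_of_tendsto' (hp L) (hp L') fun k => measureReal_mono ?_
    rintro ω ⟨Q, hQ, hY⟩
    exact ⟨Q, Set.biUnion_subset_biUnion_left (Set.Icc_subset_Icc_right hLL') hQ, hY⟩
  have hbound : ∀ L, p L ≤ 3 / 4 := by
    intro L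
    set s := (Finset.range (L + 1)).filter (fun p => p.Prime ∧ p ≠ 2) with hs
    have hlim : Tendsto (fun k => ∑ r ∈ s, (P k).real {ω | (fun t : UpperIndex n =>
        (X k ω t.1.1 t.1.2 : ZMod (r ^ 2))) ∈ isotropicEigenvectorSet r n}) atTop
        (𝓝 (∑ r ∈ s, ((isotropicEigenvectorSet r n).ncard : ℝ) /
          ((r ^ 2 : ℕ) : ℝ) ^ Fintype.card (UpperIndex n))) := by
      refine tendsto_finsetSum _ fun r hr => ?_
      have hr' : r.Prime := (Finset.mem_filter.mp hr).2.1
      have : NeZero (r ^ 2) := ⟨pow_ne_zero _ hr'.ne_zero⟩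
      exact hres (r ^ 2) _
    -- Union bound over the odd primes up to `L` for each `k ≥ 1`, passed to the limit.
    refine (le_of_tendsto_of_tendsto (hp L) hlim ?_).trans
      ((Finset.sum_le_sum fun r hr => ?_).trans (sum_three_div_odd_prime_sq_le L))
    · filter_upwards [eventually_ge_atTop 1] with k hk
      refine le_trans (measureReal_mono ?_ (measure_ne_top _ _))
        (measureReal_biUnion_finset_le s _)
      intro ω hω
      obtain ⟨r, hr, hr2, hrL, hmem⟩ :=
        HasIntegralConjugation.exists_mem_isotropicEigenvectorSet hn3 ((hX k hk).isSymm ω) hω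
      exact Set.mem_biUnion (x := r)
        (Finset.mem_filter.mpr ⟨Finset.mem_range.mpr (by omega), hr, hr2⟩) hmem
    · obtain ⟨-, hr, hr2⟩ := Finset.mem_filter.mp hr
      have : Fact r.Prime := ⟨hr⟩
      exact density_isotropicEigenvectorSet_le hn hr2
  refine ⟨p, ⨆ L, p L, hp, tendsto_atTop_ciSup hmono ⟨3 / 4, ?_⟩,
    (ciSup_le hbound).trans_lt (by norm_num)⟩
  rintro _ ⟨L, rfl⟩
  exact hbound L
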